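/- **Setting.** For a 1-current $T$ in $\mathbb{R}^2$ and a scale $\lambda>0$ let $$\mathbb{F}_\lambda(T)=\inf_{S}\big\{|T-\partial S|+\lambda\,\mathcal{A}(S)\big\},$$ where $S$ runs over the integral 2-currents in $\mathbb{R}^2$, $|\cdot|$ is the mass (length with multiplicity) of a 1-current and $\mathcal{A}(S)$ is the mass (area with multiplicity) of $S$. A PWL current with nodes $v_0,\dots,v_n$ is the sum of the oriented segments $e_j=(v_{j-1},v_j)$; it lies in $\mathcal{L}_n[s,t;\mathbb{R}^2]$ if $v_0=s$, $v_n=t$, the nodes are distinct, consecutive edges meet only in their common node and other edges are disjoint. A *positive $\delta$-perturbation* of the node $v_i$ of a PWL current $T$ replaces $v_i$ by a point $\tilde v_i$ with $\|\tilde v_i-v_i\|<\delta$ such that $\det[\tilde v_i-v_i,e]^{\mathsf T}>0$ (where $\det[x,y]^{\mathsf T}=x_1y_2-x_2y_1$) for each edge $e$ of $T$ incident to $v_i$ (two edges for an interior node, one for $v_0$ and $v_n$), and such that each new edge joining $\tilde v_i$ to a neighbour of $v_i$ meets $T$ only in that neighbour. The *region* $S_i$ swept by it is the sum of the oriented triangles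 spanned by $\tilde v_i$ and the edges incident to $v_i$; for an interior node it is the quadrilateral whose boundary is the new current minus the old one, for $i\in\{0,n\}$ it is one triangle. Let $n\ge 2$, $T_0\in\mathcal{L}_n[s,t;\mathbb{R}^2]$ and $T_1=T_0$. For $0\le k_0<k\le n$ consider sequences $$T_1=\widetilde T_1^{\,k_0-1}\rightsquigarrow\widetilde T_1^{\,k_0}\rightsquigarrow\cdots\rightsquigarrow\widetilde T_1^{\,k},$$ where $\widetilde T_1^{\,i}$ arises from $\widetilde T_1^{\,i-1}$ by a positive $\delta$-perturbation of the node $v_i$, with swept region $S_i$. The sequence satisfies the *filled-voids condition* at scale $\lambda$ if $S=S_{k_0}+\dots+S_k$ attains the infimum that defines $\mathbb{F}_\lambda(\widetilde T_1^{\,k}-T_0)$. **Corollary.** 1. There is $M_0=M_0(T_0)>0$ such that for all $\lambda>0$, all $0<\delta<M_0$, all $0\le k_0<k\le n$ and every sequence as above that satisfies the filled-voids condition, $$\mathbb{F}_\lambda(\widetilde T_1^{\,k}-T_0)=\sum_{i=k_0}^{k}\mathbb{F}_\lambda(\widetilde T_1^{\,i}-\widetilde T_1^{\,i-1}).\qquad(*)$$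 2. There is $\lambda_0=\lambda_0(T_0)>0$ such that for every $0<\lambda<\lambda_0$ there is $M=M_\lambda(T_0)>0$ such that for all $0<\delta<M$, all $1\le k_0<k\le n-1$ (only interior nodes are perturbed) and every sequence as above, the filled-voids condition is satisfied and hence $(*)$ holds. -/

import Mathlib

open MeasureTheory Set Metric
open scoped ENNReal

noncomputable section

namespace PlaneCurrent

/-- The Euclidean plane. -/
abbrev Plane : Type := EuclideanSpace ℝ (Fin 2)

/-- Smooth compactly supported differential forms of degree `d` on the plane. -/
def TestForm (d : ℕ) : Submodule ℝ (Plane → Plane [⋀^Fin d]→L[ℝ] ℝ) where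
  carrier := {φ | ContDiff ℝ (⊤ : ℕ∞) φ ∧ HasCompactSupport φ}
  add_mem' := fun h₁ h₂ => ⟨h₁.1.add h₂.1, h₁.2.add h₂.2⟩
  zero_mem' := ⟨contDiff_const, HasCompactSupport.zero⟩
  smul_mem' := fun c _ h => ⟨h.1.const_smul c, h.2.smul_left (f := fun _ => c)⟩

/-- The exterior derivative on test forms. -/
def extDerivTest (d : ℕ) : TestForm d →ₗ[ℝ] TestForm (d + 1) where
  toFun φ := ⟨extDeriv φ.1, by
    constructor
    · have h : ContDiff ℝ (⊤ : ℕ∞) (fderiv ℝ φ.1) := φ.2.1.fderiv_right (by simp)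
      exact (ContinuousAlternatingMap.alternatizeUncurryFinCLM ℝ Plane ℝ).contDiff.comp h
    · exact (φ.2.2.fderiv ℝ).comp_left (g := ContinuousAlternatingMap.alternatizeUncurryFinCLM
        (n := d) ℝ Plane ℝ) (map_zero _)⟩
  map_add' φ η := by
    ext1
    funext x
    exact extDeriv_add ((φ.2.1.differentiable (by simp)) x) ((η.2.1.differentiable (by simp)) x)
  map_smul' c φ := by
    ext1
    funext x
    exact extDeriv_smul c φ.1

/-- Linear functionals on test forms of degree `d`. No continuity is asked for here: all the
functionals considered below have finite mass, and those are automatically continuous, i.e. they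
are currents in the usual sense. -/
abbrev Current (d : ℕ) : Type := TestForm d →ₗ[ℝ] ℝ

/-- The boundary of a current, `(∂S)(φ) = S(dφ)`. -/
def boundary {d : ℕ} (S : Current (d + 1)) : Current d := S ∘ₗ extDerivTest d

/-- The mass (the `d`-dimensional volume, counted with multiplicity): the supremum of `T φ` over
the test forms of comass at most one. The operator norm of an alternating form on a Euclidean
space is its comass. -/
def mass {d : ℕ} (T : Current d) : ℝ≥0∞ :=
  ⨆ φ : {φ : TestForm d // ∀ x, ‖φ.1 x‖ ≤ 1}, ENNReal.ofReal (T φ.1)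

/-- The value of a two-form on the standard basis, i.e. the coefficient of `dx ∧ dy`. -/
def coeff (φ : TestForm 2) (x : Plane) : ℝ := φ.1 x (EuclideanSpace.basisFun (Fin 2) ℝ)

/-- Integral two-currents in the plane: compactly supported integer multiplicity rectifiable
currents, which in top dimension are given by an integrable integer valued density, whose
boundary has finite mass. -/
def IsIntegralCurrent (S : Current 2) : Prop :=
  (∃ θ : Plane → ℤ, HasCompactSupport θ ∧ Integrable (fun x => (θ x : ℝ)) ∧
    ∀ φ : TestForm 2, S φ = ∫ x, (θ x : ℝ) * coeff φ x) ∧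
  mass (boundary S) < ∞

/-- The value of the flat norm functional of `T` at the two-current `S`. -/
def flatCost (lam : ℝ) (T : Current 1) (S : Current 2) : ℝ≥0∞ :=
  mass (T - boundary S) + ENNReal.ofReal lam * mass S

/-- The multiscale flat norm of a one-current in the plane at scale `lam`. -/
def flatNorm (lam : ℝ) (T : Current 1) : ℝ≥0∞ :=
  ⨅ S : {S : Current 2 // IsIntegralCurrent S}, flatCost lam T S.1

theorem coeff_continuous (φ : TestForm 2) : Continuous (coeff φ) :=
  (ContinuousAlternatingMap.apply ℝ Plane ℝ (EuclideanSpace.basisFun (Fin 2) ℝ)).continuous.comp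
    φ.2.1.continuous

theorem coeff_integrable (φ : TestForm 2) : Integrable (coeff φ) :=
  (coeff_continuous φ).integrable_of_hasCompactSupport
    (φ.2.2.comp_left (g := fun f : Plane [⋀^Fin 2]→L[ℝ] ℝ =>
      f (EuclideanSpace.basisFun (Fin 2) ℝ)) rfl)

theorem edge_intervalIntegrable (a b : Plane) (φ : TestForm 1) :
    IntervalIntegrable (fun t : ℝ => φ.1 (a + t • (b - a)) (fun _ => b - a)) volume 0 1 := by
  apply Continuous.intervalIntegrable
  exact (ContinuousAlternatingMap.apply ℝ Plane ℝ (fun _ : Fin 1 => b - a)).continuous.comp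
    (φ.2.1.continuous.comp (by fun_prop))

/-- The one-current of the straight segment oriented from `a` to `b`. -/
def edge (a b : Plane) : Current 1 where
  toFun φ := ∫ t in (0 : ℝ)..1, φ.1 (a + t • (b - a)) (fun _ => b - a)
  map_add' φ η := by
    rw [← intervalIntegral.integral_add (edge_intervalIntegrable a b φ)
      (edge_intervalIntegrable a b η)]
    rfl
  map_smul' c φ := by
    rw [RingHom.id_apply, smul_eq_mul, ← intervalIntegral.integral_const_mul]
    rfl

/-- `det [x, y]ᵀ = x₁ y₂ - x₂ y₁`. -/
def det (x y : Plane) : ℝ := x 0 * y 1 - x 1 * y 0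

/-- The two-current of the triangle with vertices `a`, `b`, `c`, oriented by this order of the
vertices (zero if the triangle is degenerate). -/
def triangle (a b c : Plane) : Current 2 where
  toFun φ := Real.sign (det (b - a) (c - a)) * ∫ x in convexHull ℝ {a, b, c}, coeff φ x
  map_add' φ η := by
    rw [← mul_add, ← integral_add (coeff_integrable φ).integrableOn
      (coeff_integrable η).integrableOn]
    rfl
  map_smul' c φ := by
    rw [RingHom.id_apply, smul_eq_mul, mul_left_comm]
    congr 1
    rw [← integral_const_mul]
    rfl

/-- The sequence of nodes `v₀, …, vₙ` spans a simple piecewise linear curve: the nodes are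
distinct, consecutive edges meet only in their common node, and other edges do not meet. -/
def IsSimple {n : ℕ} (v : Fin (n + 1) → Plane) : Prop :=
  Function.Injective v ∧
  ∀ i j : Fin n, i < j → ∀ x, x ∈ segment ℝ (v i.castSucc) (v i.succ) →
    x ∈ segment ℝ (v j.castSucc) (v j.succ) → i.succ = j.castSucc ∧ x = v i.succ

/-- The PWL current `e₁ + ⋯ + eₙ` with nodes `v₀, …, vₙ`. -/
def pwl {n : ℕ} (v : Fin (n + 1) → Plane) : Current 1 :=
  ∑ j : Fin n, edge (v j.castSucc) (v j.succ)

/-- The support of the PWL current with nodes `v₀, …, vₙ`. -/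
def support {n : ℕ} (v : Fin (n + 1) → Plane) : Set Plane :=
  ⋃ j : Fin n, segment ℝ (v j.castSucc) (v j.succ)

/-- The positive cone at the node `i`: the points `x` of the open `δ`-ball around `v i` with
`det [x - v i, e]ᵀ > 0` for each edge `e` incident to `v i` (two edges at an interior node, one
at a boundary node). -/
def positiveCone {n : ℕ} (δ : ℝ) (v : Fin (n + 1) → Plane) (i : Fin (n + 1)) : Set Plane :=
  {x | x ∈ ball (v i) δ ∧ ∀ j : Fin n, j.castSucc = i ∨ j.succ = i →
    0 < det (x - v i) (v j.succ - v j.castSucc)}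

/-- The allowed region at the node `i`: the points `x` of the positive cone for which the new edges
joining `x` to the neighbours of `v i` meet the curve only in these neighbours. -/
def positiveRegion {n : ℕ} (δ : ℝ) (v : Fin (n + 1) → Plane) (i : Fin (n + 1)) : Set Plane :=
  {x | x ∈ positiveCone δ v i ∧
    (∀ j : Fin n, j.succ = i →
      segment ℝ (v j.castSucc) x ∩ support v ⊆ {v j.castSucc}) ∧
    (∀ j : Fin n, j.castSucc = i →
      segment ℝ x (v j.succ) ∩ support v ⊆ {v j.succ})}

/-- `w` arises from `v` by a positive `δ`-perturbation of the node `i`. -/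
def IsPositivePerturbation {n : ℕ} (δ : ℝ) (i : Fin (n + 1)) (v w : Fin (n + 1) → Plane) : Prop :=
  ∃ x ∈ positiveRegion δ v i, w = Function.update v i x

/-- `T k₀, T (k₀ + 1), …, T (k + 1)` are the node sequences of a sequence of currents which starts
at `v` and is induced by positive `δ`-perturbations of the adjacent nodes `k₀, k₀ + 1, …, k`, in
this order. So `T (i + 1)` is the outcome of the perturbation of the node `i` in `T i`. -/
def IsPositiveSequence {n : ℕ} (δ : ℝ) (k₀ k : Fin (n + 1)) (v : Fin (n + 1) → Plane)
    (T : ℕ → Fin (n + 1) → Plane) : Prop :=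
  T k₀ = v ∧ ∀ i : Fin (n + 1), k₀ ≤ i → i ≤ k → IsPositivePerturbation δ i (T i) (T (i + 1))

/-- The oriented region swept when the node `i` of `v` is moved to `x`: the sum of the triangles
spanned by `x` and the edges incident to `v i`, oriented such that the new edges are positive.
For an interior node with neighbours `p`, `q` this is the quadrilateral with boundary
`(p, x) + (x, q) - (v i, q) - (p, v i)`, for a boundary node it is a single triangle. -/
def sweptRegion {n : ℕ} (v : Fin (n + 1) → Plane) (i : Fin (n + 1)) (x : Plane) : Current 2 :=
  ∑ j : Fin n, ((if j.succ = i then triangle (v j.castSucc) x (v i) else 0) +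
    (if j.castSucc = i then triangle x (v j.succ) (v i) else 0))

/-- The void between the first and the last current of a sequence of perturbations of the nodes
`k₀, …, k`: the sum of the regions swept by the single perturbations. -/
def void {n : ℕ} (k₀ k : Fin (n + 1)) (T : ℕ → Fin (n + 1) → Plane) : Current 2 :=
  ∑ i ∈ Finset.Icc k₀ k, sweptRegion (T i) i (T (i + 1) i)

/-- The filled voids condition: filling the whole void with multiplicity one is an optimal
decomposition for the flat norm distance between the first and the last current. -/
def FilledVoids {n : ℕ} (lam : ℝ) (k₀ k : Fin (n + 1)) (T : ℕ → Fin (n + 1) → Plane) : Prop :=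
  IsIntegralCurrent (void k₀ k T) ∧
  flatCost lam (pwl (T (k + 1)) - pwl (T k₀)) (void k₀ k T) =
    flatNorm lam (pwl (T (k + 1)) - pwl (T k₀))

/-- The flat norm distance between the first and the last current of the sequence is the sum of
the flat norm distances between consecutive currents. -/
def IsAdditive {n : ℕ} (lam : ℝ) (k₀ k : Fin (n + 1)) (T : ℕ → Fin (n + 1) → Plane) : Prop :=
  flatNorm lam (pwl (T (k + 1)) - pwl (T k₀)) =
    ∑ i ∈ Finset.Icc k₀ k, flatNorm lam (pwl (T (i + 1)) - pwl (T i))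

end PlaneCurrent

end

open PlaneCurrent

/-! The cost `mass (T - ∂S) + lam * mass S` of the whole void splits into the costs of the single
swept regions, and part 2 is a calibration argument.

Part 1. By telescoping and subadditivity (`flatNorm_sum_le`) the flat norm of the total difference
is at most the sum over the steps. For the converse, if the void is optimal, its cost equals the
flat norm. Positivity of the perturbations orients all triangles positively, so the swept regions
have nonnegative densities. Their masses are then plain integrals and add up even when the regions
overlap (`HasDensityOn.mass_sum`). The residual `T - ∂S` is a sum of defects, one short segment for
each perturbed end node and zero at interior nodes (`pwl_update_sub`, `sweptDefect_eq_zero`). Each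
lies near its own node, so for small `δ` a cutoff shows that no mass cancels
(`sum_mass_le_of_separated`). The cost of the void is therefore at least the sum of the costs of the
single regions, each of which bounds a one-step flat norm from above.

Part 2. For interior nodes all defects vanish and the difference of the curves is exactly `∂S`. A
compactly supported form `ω` whose differential has comass at most one and is the area form on a
large ball (`exists_calibration`) gives, for every competitor `U`, `lam * mass S = lam * S(dω) = (∂S
- ∂U)(lam * ω) + lam * U(dω)`. Once `lam * ω` has comass at most one, the right side is at most the
cost of `U`. -/

open MeasureTheory Set Metric
open scoped ENNReal

noncomputable section

namespace PlaneCurrent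

/-! ### Forms of top degree on the plane -/

/-- The standard basis of the plane. -/
abbrev stdBasis : OrthonormalBasis (Fin 2) ℝ Plane := EuclideanSpace.basisFun (Fin 2) ℝ

theorem topForm_apply (η : Plane [⋀^Fin 2]→L[ℝ] ℝ) (v : Fin 2 → Plane) :
    η v = det (v 0) (v 1) * η stdBasis := by
  have h := AlternatingMap.eq_smul_basis_det stdBasis.toBasis η.toAlternatingMap
  have h' := congrArg (fun f => f v) h
  simp only [AlternatingMap.smul_apply, Module.Basis.det_apply, Matrix.det_fin_two,
    Module.Basis.toMatrix_apply, OrthonormalBasis.coe_toBasis_repr_apply,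
    EuclideanSpace.basisFun_repr, OrthonormalBasis.coe_toBasis, smul_eq_mul] at h'
  have h'' : η v = η stdBasis * (v 0 0 * v 1 1 - v 1 0 * v 0 1) := h'
  rw [h'', det]
  ring

/-- Lagrange's identity: the squares of the determinant and of the inner product add up to `‖x‖² *
‖y‖²`. This makes the comass of a two-form the absolute value of its coefficient. -/
theorem abs_det_le (x y : Plane) : |det x y| ≤ ‖x‖ * ‖y‖ := by
  rw [EuclideanSpace.norm_eq, EuclideanSpace.norm_eq, ← Real.sqrt_mul (by positivity)]
  apply Real.abs_le_sqrt
  simp only [Fin.sum_univ_two, Real.norm_eq_abs, sq_abs, det]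
  nlinarith [sq_nonneg (x 0 * y 0 + x 1 * y 1)]

theorem norm_topForm_le (η : Plane [⋀^Fin 2]→L[ℝ] ℝ) : ‖η‖ ≤ |η stdBasis| := by
  refine η.opNorm_le_bound (abs_nonneg _) fun v => ?_
  rw [topForm_apply, Real.norm_eq_abs, abs_mul, mul_comm, Fin.prod_univ_two]
  gcongr
  exact abs_det_le _ _

theorem abs_coeff_le (φ : TestForm 2) (x : Plane) : |coeff φ x| ≤ ‖φ.1 x‖ := by
  have h := (φ.1 x).le_opNorm stdBasis
  simpa [coeff] using h

/-- The area form `dx ∧ dy`. -/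
def areaForm : Plane [⋀^Fin 2]→L[ℝ] ℝ :=
  stdBasis.toBasis.det.mkContinuous 1 fun v => by
    have h : stdBasis.toBasis.det v = det (v 0) (v 1) := by
      simp only [Module.Basis.det_apply, Matrix.det_fin_two,
        Module.Basis.toMatrix_apply, OrthonormalBasis.coe_toBasis_repr_apply,
        EuclideanSpace.basisFun_repr, det]
      ring
    rw [h, Real.norm_eq_abs, one_mul, Fin.prod_univ_two]
    exact abs_det_le _ _

theorem areaForm_stdBasis : areaForm stdBasis = 1 := by
  change stdBasis.toBasis.det stdBasis = 1
  rw [← stdBasis.coe_toBasis, Module.Basis.det_self]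

/-! ### Mass -/

theorem ofReal_apply_le_mass {d : ℕ} (T : Current d) (φ : TestForm d) (h : ∀ x, ‖φ.1 x‖ ≤ 1) :
    ENNReal.ofReal (T φ) ≤ mass T :=
  le_iSup (fun φ : {φ : TestForm d // ∀ x, ‖φ.1 x‖ ≤ 1} => ENNReal.ofReal (T φ.1)) ⟨φ, h⟩

theorem mass_zero {d : ℕ} : mass (0 : Current d) = 0 := by
  simp [mass]

theorem mass_add_le {d : ℕ} (T U : Current d) : mass (T + U) ≤ mass T + mass U := by
  refine iSup_le fun φ => ?_
  rw [LinearMap.add_apply]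
  exact ENNReal.ofReal_add_le.trans
    (add_le_add (ofReal_apply_le_mass T φ.1 φ.2) (ofReal_apply_le_mass U φ.1 φ.2))

theorem mass_neg {d : ℕ} (T : Current d) : mass (-T) = mass T := by
  have key : ∀ U : Current d, mass (-U) ≤ mass U := fun U => by
    refine iSup_le fun φ => ?_
    have h := ofReal_apply_le_mass U (-φ.1) fun x => by
      simpa using φ.2 x
    have e : U (-φ.1) = (-U) φ.1 := LinearMap.map_neg U φ.1
    rwa [e] at h
  refine le_antisymm (key T) ?_
  simpa using key (-T)

theorem mass_sum_le {d : ℕ} {ι : Type*} (s : Finset ι) (T : ι → Current d) :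
    mass (∑ i ∈ s, T i) ≤ ∑ i ∈ s, mass (T i) := by
  classical
  induction s using Finset.induction_on with
  | empty => simp [mass_zero]
  | insert a s ha ih =>
    rw [Finset.sum_insert ha, Finset.sum_insert ha]
    exact (mass_add_le _ _).trans (by gcongr)

theorem mass_edge_le (a b : Plane) : mass (edge a b) ≤ ENNReal.ofReal ‖b - a‖ := by
  refine iSup_le fun φ => ENNReal.ofReal_le_ofReal ?_
  have h : ‖∫ t in (0 : ℝ)..1, φ.1.1 (a + t • (b - a)) (fun _ => b - a)‖ ≤ ‖b - a‖ * |1 - 0| := by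
    refine intervalIntegral.norm_integral_le_of_norm_le_const fun t _ => ?_
    refine ((φ.1.1 (a + t • (b - a))).le_opNorm _).trans ?_
    simpa using mul_le_mul_of_nonneg_right (φ.2 (a + t • (b - a))) (norm_nonneg (b - a))
  rw [sub_zero, abs_one, mul_one] at h
  exact (le_abs_self _).trans h

/-! ### Currents with nonnegative density -/

/-- `S` is the integration current of a nonnegative integer valued density which vanishes outside
the set `K`. -/
def HasDensityOn (K : Set Plane) (S : Current 2) : Prop :=
  ∃ θ : Plane → ℤ, (∀ x, 0 ≤ θ x) ∧ (∀ x, x ∉ K → θ x = 0) ∧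
    Integrable (fun x => (θ x : ℝ)) ∧ ∀ φ : TestForm 2, S φ = ∫ x, (θ x : ℝ) * coeff φ x

theorem integrable_mul_coeff {θ : Plane → ℝ} (hθ : Integrable θ) (φ : TestForm 2) :
    Integrable fun x => θ x * coeff φ x := by
  obtain ⟨C, hC⟩ := (φ.2.2.comp_left (g := fun f : Plane [⋀^Fin 2]→L[ℝ] ℝ =>
      f (EuclideanSpace.basisFun (Fin 2) ℝ)) rfl).exists_bound_of_continuous (coeff_continuous φ)
  exact hθ.mul_bdd (coeff_continuous φ).aestronglyMeasurable (Filter.Eventually.of_forall hC)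

theorem HasDensityOn.zero (K : Set Plane) : HasDensityOn K 0 :=
  ⟨fun _ => 0, fun _ => le_rfl, fun _ _ => rfl, by simp, fun φ => by simp⟩

theorem HasDensityOn.add {K : Set Plane} {S U : Current 2} (hS : HasDensityOn K S)
    (hU : HasDensityOn K U) : HasDensityOn K (S + U) := by
  obtain ⟨θ, h0, hK, hi, hθ⟩ := hS
  obtain ⟨η, h0', hK', hi', hη⟩ := hU
  refine ⟨θ + η, fun x => add_nonneg (h0 x) (h0' x), fun x hx => by simp [hK x hx, hK' x hx],
    (hi.add hi').congr (Filter.Eventually.of_forall fun x => by simp), fun φ => ?_⟩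
  rw [LinearMap.add_apply, hθ, hη,
    ← integral_add (integrable_mul_coeff hi φ) (integrable_mul_coeff hi' φ)]
  simp [add_mul]

theorem HasDensityOn.sum {K : Set Plane} {ι : Type*} {s : Finset ι} {S : ι → Current 2}
    (h : ∀ i ∈ s, HasDensityOn K (S i)) : HasDensityOn K (∑ i ∈ s, S i) := by
  classical
  induction s using Finset.induction_on with
  | empty => simpa using HasDensityOn.zero K
  | insert a s ha ih =>
    rw [Finset.sum_insert ha]
    exact (h a (Finset.mem_insert_self a s)).add
      (ih fun i hi => h i (Finset.mem_insert_of_mem hi))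

/-- A test form of comass at most one which is the area form on a given ball. -/
theorem exists_testForm_area (R : ℝ) : ∃ φ : TestForm 2, (∀ x, ‖φ.1 x‖ ≤ 1) ∧
    ∀ x ∈ ball (0 : Plane) R, coeff φ x = 1 := by
  let b : ContDiffBump (0 : Plane) := ⟨max R 1, max R 1 + 1, by positivity, by linarith⟩
  refine ⟨⟨fun x => b x • areaForm, b.contDiff.smul contDiff_const,
    b.hasCompactSupport.smul_right⟩, fun x => ?_, fun x hx => ?_⟩
  · change ‖b x • areaForm‖ ≤ 1
    rw [norm_smul, Real.norm_of_nonneg b.nonneg]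
    have h := norm_topForm_le areaForm
    rw [areaForm_stdBasis, abs_one] at h
    exact mul_le_one₀ b.le_one (norm_nonneg _) h
  · change (b x • areaForm) stdBasis = 1
    rw [b.one_of_mem_closedBall (ball_subset_closedBall (ball_subset_ball (le_max_left _ _) hx))]
    simp [areaForm_stdBasis]

theorem apply_le_integral_density {θ : Plane → ℤ} (h0 : ∀ x, 0 ≤ θ x)
    (hi : Integrable (fun x => (θ x : ℝ))) (φ : TestForm 2) (hφ : ∀ x, ‖φ.1 x‖ ≤ 1) :
    ∫ x, (θ x : ℝ) * coeff φ x ≤ ∫ x, (θ x : ℝ) := by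
  refine integral_mono (integrable_mul_coeff hi φ) hi fun x => ?_
  exact mul_le_of_le_one_right (Int.cast_nonneg (h0 x))
    ((le_abs_self _).trans ((abs_coeff_le φ x).trans (hφ x)))

/-- Without sign changes in the density, the area form is optimal, so mass becomes evaluation at one
fixed form and is linear. The form is left free because it is a cut-off area form in
`HasDensityOn.mass_sum` and the differential of the calibration in `flatCost_le_of_calibration`. -/
theorem HasDensityOn.mass_eq {R : ℝ} {S : Current 2} (hS : HasDensityOn (ball 0 R) S)
    {φ : TestForm 2} (hφ : ∀ x, ‖φ.1 x‖ ≤ 1) (h1 : ∀ x ∈ ball (0 : Plane) R, coeff φ x = 1) :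
    mass S = ENNReal.ofReal (S φ) := by
  obtain ⟨θ, h0, hK, hi, hθ⟩ := hS
  have e : S φ = ∫ x, (θ x : ℝ) := by
    rw [hθ]
    refine integral_congr_ae (Filter.Eventually.of_forall fun x => ?_)
    by_cases hx : x ∈ ball (0 : Plane) R
    · simp [h1 x hx]
    · simp [hK x hx]
  refine le_antisymm (iSup_le fun ψ => ENNReal.ofReal_le_ofReal ?_) (ofReal_apply_le_mass S φ hφ)
  rw [e, hθ]
  exact apply_le_integral_density h0 hi ψ.1 ψ.2

theorem HasDensityOn.apply_nonneg {R : ℝ} {S : Current 2} (hS : HasDensityOn (ball 0 R) S)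
    {φ : TestForm 2} (h1 : ∀ x ∈ ball (0 : Plane) R, coeff φ x = 1) : 0 ≤ S φ := by
  obtain ⟨θ, h0, hK, hi, hθ⟩ := hS
  rw [hθ]
  refine integral_nonneg fun x => ?_
  by_cases hx : x ∈ ball (0 : Plane) R
  · simpa [h1 x hx] using h0 x
  · simp [hK x hx]

theorem HasDensityOn.mass_sum {R : ℝ} {ι : Type*} {s : Finset ι} {S : ι → Current 2}
    (h : ∀ i ∈ s, HasDensityOn (ball 0 R) (S i)) :
    mass (∑ i ∈ s, S i) = ∑ i ∈ s, mass (S i) := by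
  obtain ⟨φ, hφ, h1⟩ := exists_testForm_area R
  rw [(HasDensityOn.sum h).mass_eq hφ h1, LinearMap.sum_apply,
    ENNReal.ofReal_sum_of_nonneg fun i hi => (h i hi).apply_nonneg h1]
  exact Finset.sum_congr rfl fun i hi => ((h i hi).mass_eq hφ h1).symm

theorem HasDensityOn.isIntegralCurrent {R : ℝ} {S : Current 2} (hS : HasDensityOn (ball 0 R) S)
    (hb : mass (boundary S) < ∞) : IsIntegralCurrent S := by
  obtain ⟨θ, -, hK, hi, hθ⟩ := hS
  refine ⟨⟨θ, ?_, hi, hθ⟩, hb⟩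
  exact HasCompactSupport.intro (isCompact_closedBall (0 : Plane) R) fun x hx =>
    hK x fun h => hx (ball_subset_closedBall h)

/-! ### Stokes' theorem for a triangle -/

/-- The standard simplex in `ℝ × ℝ`. -/
def simplex : Set (ℝ × ℝ) := {p | 0 ≤ p.1 ∧ 0 ≤ p.2 ∧ p.1 + p.2 ≤ 1}

theorem isCompact_simplex : IsCompact simplex := by
  refine (isCompact_Icc (a := ((0 : ℝ), (0 : ℝ))) (b := (1, 1))).of_isClosed_subset ?_ ?_
  · exact (isClosed_le continuous_const continuous_fst).inter
      ((isClosed_le continuous_const continuous_snd).inter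
        (isClosed_le (continuous_fst.add continuous_snd) continuous_const))
  · rintro ⟨s, t⟩ ⟨h1, h2, h3⟩
    simp only at h1 h2 h3
    exact ⟨⟨h1, h2⟩, ⟨by simp only; linarith, by simp only; linarith⟩⟩

theorem integral_simplex {h : ℝ × ℝ → ℝ} (hh : Continuous h) :
    ∫ p in simplex, h p = ∫ s in (0 : ℝ)..1, ∫ t in (0 : ℝ)..(1 - s), h (s, t) := by
  have hm : MeasurableSet simplex := isCompact_simplex.isClosed.measurableSet
  rw [← integral_indicator hm, Measure.volume_eq_prod, integral_prod]
  swap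
  · rw [← Measure.volume_eq_prod, integrable_indicator_iff hm]
    exact hh.continuousOn.integrableOn_compact isCompact_simplex
  rw [intervalIntegral.integral_of_le zero_le_one, ← integral_Icc_eq_integral_Ioc,
    ← integral_indicator measurableSet_Icc]
  refine integral_congr_ae (Filter.Eventually.of_forall fun s => ?_)
  by_cases hs : s ∈ Icc (0 : ℝ) 1
  · simp only [indicator_of_mem hs]
    rw [intervalIntegral.integral_of_le (by linarith [hs.2]), ← integral_Icc_eq_integral_Ioc,
      ← integral_indicator measurableSet_Icc]
    refine integral_congr_ae (Filter.Eventually.of_forall fun t => ?_)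
    have : (s, t) ∈ simplex ↔ t ∈ Icc 0 (1 - s) :=
      ⟨fun h => ⟨h.2.1, by linarith [h.2.2]⟩, fun h => ⟨hs.1, h.1, by simp only; linarith [h.2]⟩⟩
    by_cases ht : t ∈ Icc 0 (1 - s)
    · simp [indicator_of_mem ht, indicator_of_mem (this.2 ht)]
    · simp [indicator_of_notMem ht, indicator_of_notMem (fun h => ht (this.1 h))]
  · simp only [indicator_of_notMem hs]
    refine integral_eq_zero_of_ae (Filter.Eventually.of_forall fun t => ?_)
    refine indicator_of_notMem (fun h => hs ⟨h.1, ?_⟩) _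
    linarith [h.2.1, h.2.2]

/-- The simplex is symmetric under exchange of coordinates. Stokes' theorem needs both orders of
integration, one for each partial derivative. -/
theorem integral_simplex_swap {h : ℝ × ℝ → ℝ} (hh : Continuous h) :
    ∫ p in simplex, h p = ∫ t in (0 : ℝ)..1, ∫ s in (0 : ℝ)..(1 - t), h (s, t) := by
  have e := (Measure.measurePreserving_swap (μ := (volume : Measure ℝ))
    (ν := (volume : Measure ℝ))).setIntegral_preimage_emb
      MeasurableEquiv.prodComm.measurableEmbedding h simplex
  have hs : Prod.swap ⁻¹' simplex = simplex := by
    ext ⟨s, t⟩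
    simp only [simplex, mem_preimage, mem_ofPred_eq, Prod.swap_prod_mk]
    constructor <;> rintro ⟨h1, h2, h3⟩ <;> exact ⟨h2, h1, by linarith⟩
  rw [hs, ← Measure.volume_eq_prod] at e
  rw [← e]
  exact integral_simplex (hh.comp continuous_swap)

/-- The coordinates of the plane. -/
def planeCoord (p : Plane) : ℝ × ℝ := (p 0, p 1)

theorem measurePreserving_planeCoord : MeasurePreserving planeCoord volume volume :=
  (volume_preserving_finTwoArrow ℝ).comp
    (EuclideanSpace.volume_preserving_symm_measurableEquiv_toLp (Fin 2))

theorem measurableEmbedding_planeCoord : MeasurableEmbedding planeCoord :=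
  (MeasurableEquiv.finTwoArrow (α := ℝ)).measurableEmbedding.comp
    (MeasurableEquiv.toLp 2 (Fin 2 → ℝ)).symm.measurableEmbedding

/-- The affine map which sends the standard simplex to the triangle `a`, `a + u`, `a + w`. -/
def simplexMap (a u w : Plane) (p : Plane) : Plane := a + (p 0 • u + p 1 • w)

/-- The linear part of `simplexMap`. -/
def simplexLin (u w : Plane) : Plane →L[ℝ] Plane :=
  (EuclideanSpace.proj (0 : Fin 2) : Plane →L[ℝ] ℝ).smulRight u +
    (EuclideanSpace.proj (1 : Fin 2) : Plane →L[ℝ] ℝ).smulRight w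

theorem simplexLin_apply (u w p : Plane) : simplexLin u w p = p 0 • u + p 1 • w := rfl

theorem det_simplexLin (u w : Plane) : (simplexLin u w).det = det u w := by
  rw [ContinuousLinearMap.det, ← LinearMap.det_toMatrix stdBasis.toBasis, Matrix.det_fin_two]
  simp [LinearMap.toMatrix_apply, simplexLin_apply, det]
  ring

theorem image_simplexMap (a b c : Plane) :
    simplexMap a (b - a) (c - a) '' (planeCoord ⁻¹' simplex) = convexHull ℝ {a, b, c} := by
  apply Subset.antisymm
  · rintro _ ⟨p, ⟨h1, h2, h3⟩, rfl⟩
    simp only [planeCoord] at h1 h2 h3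
    have hC := convex_convexHull ℝ ({a, b, c} : Set Plane)
    have h := hC.sum_mem (t := Finset.univ) (w := ![1 - p 0 - p 1, p 0, p 1]) (z := ![a, b, c])
      (fun i _ => by fin_cases i <;> simp <;> linarith) (by simp [Fin.sum_univ_three]; ring)
      (fun i _ => subset_convexHull ℝ _ (by fin_cases i <;> simp))
    convert h using 1
    simp only [simplexMap, Fin.sum_univ_three, Matrix.cons_val_zero, Matrix.cons_val_one,
      Matrix.cons_val]
    module
  · refine convexHull_min ?_ ?_
    · rintro x (rfl | rfl | rfl)
      · exact ⟨!₂[0, 0], by simp [planeCoord, simplex], by simp [simplexMap]⟩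
      · exact ⟨!₂[1, 0], by simp [planeCoord, simplex], by simp [simplexMap]⟩
      · exact ⟨!₂[0, 1], by simp [planeCoord, simplex], by simp [simplexMap]⟩
    · rintro _ ⟨p, ⟨h1, h2, h3⟩, rfl⟩ _ ⟨q, ⟨g1, g2, g3⟩, rfl⟩ α β hα hβ hαβ
      simp only [planeCoord] at h1 h2 h3 g1 g2 g3
      refine ⟨α • p + β • q, ⟨?_, ?_, ?_⟩, ?_⟩
      · simp only [planeCoord, PiLp.add_apply, PiLp.smul_apply, smul_eq_mul]
        positivity
      · simp only [planeCoord, PiLp.add_apply, PiLp.smul_apply, smul_eq_mul]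
        positivity
      · simp only [planeCoord, PiLp.add_apply, PiLp.smul_apply, smul_eq_mul]
        nlinarith
      · simp only [simplexMap, PiLp.add_apply, PiLp.smul_apply, smul_eq_mul]
        have : a = (α + β) • a := by rw [hαβ, one_smul]
        nth_rw 1 [this]
        module

theorem simplexLin_injective {u w : Plane} (h : det u w ≠ 0) :
    Function.Injective (simplexLin u w) := by
  rw [injective_iff_map_eq_zero]
  intro p hp
  rw [simplexLin_apply] at hp
  have e0 := congrArg (fun x : Plane => x 0) hp
  have e1 := congrArg (fun x : Plane => x 1) hp
  simp only [PiLp.add_apply, PiLp.smul_apply, smul_eq_mul, PiLp.zero_apply] at e0 e1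
  unfold det at h
  have h0 : p 0 = 0 := by
    apply mul_right_cancel₀ h
    linear_combination w 1 * e0 - w 0 * e1
  have h1 : p 1 = 0 := by
    apply mul_right_cancel₀ h
    linear_combination u 0 * e1 - u 1 * e0
  ext i
  fin_cases i <;> simp [h0, h1]

theorem integral_convexHull_triple {a b c : Plane} (h : 0 < det (b - a) (c - a)) {g : Plane → ℝ} :
    ∫ x in convexHull ℝ {a, b, c}, g x =
      ∫ p in simplex, det (b - a) (c - a) * g (a + (p.1 • (b - a) + p.2 • (c - a))) := by
  rw [← image_simplexMap, integral_image_eq_integral_abs_det_fderiv_smul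
    (f' := fun _ => simplexLin (b - a) (c - a))]
  · rw [← measurePreserving_planeCoord.setIntegral_preimage_emb measurableEmbedding_planeCoord]
    simp only [det_simplexLin, abs_of_pos h, smul_eq_mul, planeCoord, simplexMap]
  · exact measurePreserving_planeCoord.measurable isCompact_simplex.isClosed.measurableSet
  · intro x _
    exact ((simplexLin (b - a) (c - a)).hasFDerivAt.const_add a).hasFDerivWithinAt
  · intro p _ q _ e
    exact simplexLin_injective h.ne' (add_left_cancel e)

theorem extDeriv_one_apply {φ : Plane → Plane [⋀^Fin 1]→L[ℝ] ℝ} (v : Fin 2 → Plane) (x : Plane) :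
    extDeriv φ x v = fderiv ℝ φ x (v 0) (fun _ => v 1) - fderiv ℝ φ x (v 1) (fun _ => v 0) := by
  rw [extDeriv, ContinuousAlternatingMap.alternatizeUncurryFin_apply, Fin.sum_univ_two]
  have h0 : (0 : Fin 2).removeNth v = fun _ => v 1 := by
    ext i : 1; fin_cases i; rfl
  have h1 : (1 : Fin 2).removeNth v = fun _ => v 0 := by
    ext i : 1; fin_cases i; rfl
  rw [h0, h1]
  simp [sub_eq_add_neg]

theorem edge_apply_eq (a b : Plane) (φ : TestForm 1) :
    edge a b φ = ∫ t in (0 : ℝ)..1, φ.1 (a + t • (b - a)) (fun _ => b - a) := rfl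

theorem edge_swap (a b : Plane) : edge b a = -edge a b := by
  ext φ
  rw [LinearMap.neg_apply, edge_apply_eq, edge_apply_eq]
  have h := intervalIntegral.integral_comp_sub_left (a := 0) (b := 1)
    (fun t : ℝ => φ.1 (a + t • (b - a)) (fun _ => b - a)) 1
  rw [sub_self, sub_zero] at h
  rw [← h, ← intervalIntegral.integral_neg]
  refine intervalIntegral.integral_congr fun t _ => ?_
  have e1 : b + t • (a - b) = a + (1 - t) • (b - a) := by module
  have e2 := (ContinuousAlternatingMap.ofSubsingleton ℝ Plane ℝ (0 : Fin 1)).symm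
    (φ.1 (a + (1 - t) • (b - a))) |>.map_neg (b - a)
  rw [neg_sub] at e2
  simp only [e1]
  exact e2

theorem integral_fderiv_segment (φ : TestForm 1) (x u w : Plane) (r : ℝ) :
    ∫ s in (0 : ℝ)..r, fderiv ℝ φ.1 (x + s • u) u (fun _ => w) =
      φ.1 (x + r • u) (fun _ => w) - φ.1 x (fun _ => w) := by
  have hd : ∀ s : ℝ, HasDerivAt (fun s : ℝ => φ.1 (x + s • u) (fun _ => w))
      (fderiv ℝ φ.1 (x + s • u) u (fun _ => w)) s := fun s => by
    have h1 : HasDerivAt (fun s : ℝ => x + s • u) u s := by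
      simpa using ((hasDerivAt_id s).smul_const u).const_add x
    have h2 := ((φ.2.1.differentiable (by simp)) (x + s • u)).hasFDerivAt.comp_hasDerivAt s h1
    exact (ContinuousAlternatingMap.apply ℝ Plane ℝ
      (fun _ : Fin 1 => w)).hasFDerivAt.comp_hasDerivAt s h2
  rw [intervalIntegral.integral_eq_sub_of_hasDerivAt (fun s _ => hd s)]
  · simp
  · apply Continuous.intervalIntegrable
    have hc : Continuous (fderiv ℝ φ.1) := φ.2.1.continuous_fderiv (by simp)
    exact (ContinuousAlternatingMap.apply ℝ Plane ℝ (fun _ : Fin 1 => w)).continuous.comp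
      ((hc.comp (by fun_prop)).clm_apply continuous_const)

/-- Pulled back to the standard simplex, the exterior derivative is a difference of two directional
derivatives. Each is integrated first along its own direction by the fundamental theorem of
calculus, which leaves one leg and the hypotenuse. The two hypotenuse terms combine because `c - b =
w - u`. -/
theorem boundary_triangle {a b c : Plane} (h : 0 < det (b - a) (c - a)) :
    boundary (triangle a b c) = edge a b + edge b c + edge c a := by
  ext φ
  set u := b - a with hu
  set w := c - a with hw
  have hc : Continuous (fderiv ℝ φ.1) := φ.2.1.continuous_fderiv (by simp)
  have hA : ∀ y z : Plane, Continuous fun p : ℝ × ℝ =>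
      fderiv ℝ φ.1 (a + (p.1 • u + p.2 • w)) y (fun _ => z) := fun y z =>
    (ContinuousAlternatingMap.apply ℝ Plane ℝ (fun _ : Fin 1 => z)).continuous.comp
      ((hc.comp (by fun_prop)).clm_apply continuous_const)
  have e : boundary (triangle a b c) φ =
      ∫ p in simplex, (fderiv ℝ φ.1 (a + (p.1 • u + p.2 • w)) u (fun _ => w) -
        fderiv ℝ φ.1 (a + (p.1 • u + p.2 • w)) w (fun _ => u)) := by
    change Real.sign (det u w) * ∫ x in convexHull ℝ {a, b, c}, coeff (extDerivTest 1 φ) x = _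
    rw [Real.sign_of_pos h, one_mul, integral_convexHull_triple h]
    refine integral_congr_ae (Filter.Eventually.of_forall fun p => ?_)
    have h1 := topForm_apply (extDeriv φ.1 (a + (p.1 • u + p.2 • w))) ![u, w]
    rw [extDeriv_one_apply] at h1
    exact h1.symm
  rw [e, integral_sub ((hA u w).continuousOn.integrableOn_compact isCompact_simplex)
    ((hA w u).continuousOn.integrableOn_compact isCompact_simplex),
    integral_simplex_swap (hA u w), integral_simplex (hA w u)]
  have i1 : ∀ t : ℝ, ∫ s in (0 : ℝ)..(1 - t), fderiv ℝ φ.1 (a + (s • u + t • w)) u (fun _ => w) =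
      φ.1 (b + t • (c - b)) (fun _ => w) - φ.1 (a + t • (c - a)) (fun _ => w) := fun t => by
    have h1 := integral_fderiv_segment φ (a + t • w) u w (1 - t)
    have e1 : a + t • w + (1 - t) • u = b + t • (c - b) := by rw [hu, hw]; module
    rw [e1] at h1
    rw [← hw, ← h1]
    refine intervalIntegral.integral_congr fun s _ => ?_
    have e2 : a + (s • u + t • w) = a + t • w + s • u := by module
    simp only [e2]
  have i2 : ∀ s : ℝ, ∫ t in (0 : ℝ)..(1 - s), fderiv ℝ φ.1 (a + (s • u + t • w)) w (fun _ => u) =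
      φ.1 (b + (1 - s) • (c - b)) (fun _ => u) - φ.1 (a + s • (b - a)) (fun _ => u) := fun s => by
    have h1 := integral_fderiv_segment φ (a + s • u) w u (1 - s)
    have e1 : a + s • u + (1 - s) • w = b + (1 - s) • (c - b) := by rw [hu, hw]; module
    rw [e1] at h1
    rw [← hu, ← h1]
    refine intervalIntegral.integral_congr fun t _ => ?_
    have e2 : a + (s • u + t • w) = a + s • u + t • w := by module
    simp only [e2]
  simp only [i1, i2]
  have hI : ∀ x y z : Plane, IntervalIntegrable
      (fun t : ℝ => φ.1 (x + t • (y - x)) (fun _ => z)) volume 0 1 := fun x y z =>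
    ((ContinuousAlternatingMap.apply ℝ Plane ℝ (fun _ : Fin 1 => z)).continuous.comp
      (φ.2.1.continuous.comp (by fun_prop))).intervalIntegrable _ _
  have hI' : IntervalIntegrable
      (fun s : ℝ => φ.1 (b + (1 - s) • (c - b)) (fun _ => u)) volume 0 1 :=
    ((ContinuousAlternatingMap.apply ℝ Plane ℝ (fun _ : Fin 1 => u)).continuous.comp
      (φ.2.1.continuous.comp (by fun_prop))).intervalIntegrable _ _
  have hrev : ∫ s in (0 : ℝ)..1, φ.1 (b + (1 - s) • (c - b)) (fun _ => u) =
      ∫ t in (0 : ℝ)..1, φ.1 (b + t • (c - b)) (fun _ => u) := by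
    have := intervalIntegral.integral_comp_sub_left (a := 0) (b := 1)
      (fun t : ℝ => φ.1 (b + t • (c - b)) (fun _ => u)) 1
    simpa using this
  rw [intervalIntegral.integral_sub (hI _ _ _) (hI _ _ _),
    intervalIntegral.integral_sub hI' (hI _ _ _), hrev, LinearMap.add_apply, LinearMap.add_apply,
    edge_swap a c, LinearMap.neg_apply, edge_apply_eq, edge_apply_eq, edge_apply_eq]
  have hbc : ∫ t in (0 : ℝ)..1, φ.1 (b + t • (c - b)) (fun _ => c - b) =
      (∫ t in (0 : ℝ)..1, φ.1 (b + t • (c - b)) (fun _ => w)) -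
        ∫ t in (0 : ℝ)..1, φ.1 (b + t • (c - b)) (fun _ => u) := by
    rw [← intervalIntegral.integral_sub (hI _ _ _) (hI _ _ _)]
    refine intervalIntegral.integral_congr fun t _ => ?_
    have e3 : c - b = w - u := by rw [hu, hw]; abel
    have e4 := (ContinuousAlternatingMap.ofSubsingleton ℝ Plane ℝ (0 : Fin 1)).symm
      (φ.1 (b + t • (c - b))) |>.map_sub w u
    simp only [e3] at e4 ⊢
    exact e4
  rw [hbc]
  ring

theorem hasDensityOn_triangle {a b c : Plane} (h : 0 < det (b - a) (c - a)) {K : Set Plane}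
    (hK : Convex ℝ K) (ha : a ∈ K) (hb : b ∈ K) (hc : c ∈ K) :
    HasDensityOn K (triangle a b c) := by
  have hcomp : IsCompact (convexHull ℝ ({a, b, c} : Set Plane)) :=
    (Set.toFinite _).isCompact_convexHull ℝ
  have hm := hcomp.isClosed.measurableSet
  have hsub : convexHull ℝ ({a, b, c} : Set Plane) ⊆ K :=
    convexHull_min (by rintro x (rfl | rfl | rfl) <;> assumption) hK
  have hθ : (fun x => (((convexHull ℝ {a, b, c}).indicator (fun _ => (1 : ℤ)) x : ℤ) : ℝ)) =
      (convexHull ℝ ({a, b, c} : Set Plane)).indicator fun _ => (1 : ℝ) := by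
    ext x
    by_cases hx : x ∈ convexHull ℝ ({a, b, c} : Set Plane) <;> simp [hx]
  refine ⟨(convexHull ℝ {a, b, c}).indicator fun _ => 1,
    fun x => indicator_nonneg (fun _ _ => zero_le_one) x,
    fun x hx => indicator_of_notMem (fun h => hx (hsub h)) _, ?_, fun φ => ?_⟩
  · rw [hθ, integrable_indicator_iff hm]
    exact continuous_const.continuousOn.integrableOn_compact hcomp
  · change Real.sign (det (b - a) (c - a)) * ∫ x in convexHull ℝ {a, b, c}, coeff φ x = _
    rw [Real.sign_of_pos h, one_mul, ← integral_indicator hm]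
    refine integral_congr_ae (Filter.Eventually.of_forall fun x => ?_)
    by_cases hx : x ∈ convexHull ℝ ({a, b, c} : Set Plane) <;> simp [hx]

/-! ### Additivity of the mass of separated currents -/

/-- The values of `T` depend only on the restriction of the test form to `K`. -/
def SupportedIn {d : ℕ} (K : Set Plane) (T : Current d) : Prop :=
  ∀ φ ψ : TestForm d, (∀ x ∈ K, φ.1 x = ψ.1 x) → T φ = T ψ

theorem SupportedIn.mono {d : ℕ} {K L : Set Plane} {T : Current d} (h : SupportedIn K T)
    (hKL : K ⊆ L) : SupportedIn L T :=
  fun φ ψ e => h φ ψ fun x hx => e x (hKL hx)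

theorem SupportedIn.zero {d : ℕ} (K : Set Plane) : SupportedIn K (0 : Current d) :=
  fun _ _ _ => rfl

theorem SupportedIn.add {d : ℕ} {K : Set Plane} {T U : Current d} (hT : SupportedIn K T)
    (hU : SupportedIn K U) : SupportedIn K (T + U) := fun φ ψ e => by
  rw [LinearMap.add_apply, LinearMap.add_apply, hT φ ψ e, hU φ ψ e]

theorem SupportedIn.sub {d : ℕ} {K : Set Plane} {T U : Current d} (hT : SupportedIn K T)
    (hU : SupportedIn K U) : SupportedIn K (T - U) := fun φ ψ e => by
  rw [LinearMap.sub_apply, LinearMap.sub_apply, hT φ ψ e, hU φ ψ e]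

theorem SupportedIn.sum {d : ℕ} {K : Set Plane} {ι : Type*} {s : Finset ι} {T : ι → Current d}
    (h : ∀ i ∈ s, SupportedIn K (T i)) : SupportedIn K (∑ i ∈ s, T i) := fun φ ψ e => by
  rw [LinearMap.sum_apply, LinearMap.sum_apply]
  exact Finset.sum_congr rfl fun i hi => h i hi φ ψ e

theorem supportedIn_edge {K : Set Plane} (hK : Convex ℝ K) {a b : Plane} (ha : a ∈ K)
    (hb : b ∈ K) : SupportedIn K (edge a b) := fun φ ψ e => by
  rw [edge_apply_eq, edge_apply_eq]
  refine intervalIntegral.integral_congr fun t ht => ?_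
  rw [uIcc_of_le zero_le_one] at ht
  simp only [e _ (hK.add_smul_sub_mem ha hb ht)]

/-- The product of a smooth function and a test form. -/
def smulTestForm {d : ℕ} (f : Plane → ℝ) (hf : ContDiff ℝ (⊤ : ℕ∞) f) (φ : TestForm d) :
    TestForm d :=
  ⟨fun x => f x • φ.1 x, hf.smul φ.2.1, φ.2.2.smul_left (f := f)⟩

/-- Test forms for `T` and for `U` are glued with a cutoff that lives in the gap between the radii
`r` and `M`. The glued form is pointwise a convex combination, so its comass stays at most one. -/
theorem mass_add_of_separated {d : ℕ} {T U : Current d} {z : Plane} {r M : ℝ} (hr : 0 < r)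
    (hM : r < M) (hT : SupportedIn (ball z r) T) (hU : SupportedIn (ball z M)ᶜ U) :
    mass T + mass U ≤ mass (T + U) := by
  let b : ContDiffBump z := ⟨r, M, hr, hM⟩
  have : Nonempty {φ : TestForm d // ∀ x, ‖φ.1 x‖ ≤ 1} := ⟨0, fun x => by simp⟩
  -- `ENNReal.ofReal` truncates negative values to zero, so a form with a negative value can be
  -- replaced by the zero form. Afterwards the two values add without truncation.
  have pos : ∀ (V : Current d) (φ : {φ : TestForm d // ∀ x, ‖φ.1 x‖ ≤ 1}),
      ∃ ψ : {φ : TestForm d // ∀ x, ‖φ.1 x‖ ≤ 1}, 0 ≤ V ψ.1 ∧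
        ENNReal.ofReal (V φ.1) = ENNReal.ofReal (V ψ.1) := fun V φ => by
    rcases le_total 0 (V φ.1) with h | h
    · exact ⟨φ, h, rfl⟩
    · refine ⟨⟨0, fun x => by simp⟩, by simp, ?_⟩
      rw [ENNReal.ofReal_of_nonpos h, map_zero, ENNReal.ofReal_zero]
  refine ENNReal.iSup_add_iSup_le fun φ₀ ψ₀ => ?_
  obtain ⟨φ, hφ, eφ⟩ := pos T φ₀
  obtain ⟨ψ, hψ, eψ⟩ := pos U ψ₀
  rw [eφ, eψ, ← ENNReal.ofReal_add hφ hψ]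
  have hb' : ContDiff ℝ (⊤ : ℕ∞) fun x => 1 - b x := contDiff_const.sub b.contDiff
  let ω : TestForm d := smulTestForm b b.contDiff φ.1 + smulTestForm (fun x => 1 - b x) hb' ψ.1
  have hω : ∀ x, ω.1 x = b x • φ.1.1 x + (1 - b x) • ψ.1.1 x := fun x => rfl
  have hTω : T ω = T φ.1 := hT _ _ fun x hx => by
    rw [hω, b.one_of_mem_closedBall (ball_subset_closedBall hx)]
    simp
  have hUω : U ω = U ψ.1 := hU _ _ fun x hx => by
    have hx' : M ≤ dist x z := by simpa using hx
    rw [hω, b.zero_of_le_dist hx']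
    simp
  rw [← hTω, ← hUω, ← LinearMap.add_apply]
  refine ofReal_apply_le_mass _ ω fun x => ?_
  rw [hω]
  refine (norm_add_le _ _).trans ?_
  rw [norm_smul, norm_smul, Real.norm_of_nonneg b.nonneg,
    Real.norm_of_nonneg (sub_nonneg.2 b.le_one)]
  have h1 := mul_le_mul_of_nonneg_left (φ.2 x) (b.nonneg (x := x))
  have h2 := mul_le_mul_of_nonneg_left (ψ.2 x) (sub_nonneg.2 (b.le_one (x := x)))
  linarith

theorem sum_mass_le_of_separated {d : ℕ} {ι : Type*} {s : Finset ι} {D : ι → Current d}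
    {z : ι → Plane} {r M : ℝ} (hr : 0 < r) (hM : r < M)
    (hz : ∀ i j, i ≠ j → 2 * M ≤ dist (z i) (z j))
    (hD : ∀ i ∈ s, SupportedIn (ball (z i) r) (D i)) :
    ∑ i ∈ s, mass (D i) ≤ mass (∑ i ∈ s, D i) := by
  classical
  induction s using Finset.induction_on with
  | empty => simp
  | insert a s ha ih =>
    rw [Finset.sum_insert ha, Finset.sum_insert ha]
    have hs : SupportedIn (ball (z a) M)ᶜ (∑ i ∈ s, D i) := SupportedIn.sum fun i hi => by
      refine (hD i (Finset.mem_insert_of_mem hi)).mono fun x hx hx' => ?_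
      have h1 := hz i a fun e => ha (e ▸ hi)
      have h2 := dist_triangle_left (z i) (z a) x
      rw [mem_ball] at hx hx'
      linarith
    refine le_trans ?_ (mass_add_of_separated hr hM (hD a (Finset.mem_insert_self a s)) hs)
    gcongr
    exact ih fun i hi => hD i (Finset.mem_insert_of_mem hi)

/-! ### The calibrating form -/

/-- A bounded form whose exterior derivative has comass at most one and is the area form on a
given ball. -/
theorem exists_calibration {R : ℝ} (hR : 0 < R) : ∃ C : ℝ, 0 < C ∧ ∃ ω : TestForm 1,
    (∀ x, ‖ω.1 x‖ ≤ C) ∧ (∀ x, ‖(extDerivTest 1 ω).1 x‖ ≤ 1) ∧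
    ∀ x ∈ ball (0 : Plane) R, coeff (extDerivTest 1 ω) x = 1 := by
  let b : ContDiffBump (0 : ℝ) := ⟨R, 2 * R, hR, by linarith⟩
  have b_zero : ∀ t : ℝ, 2 * R ≤ |t| → b t = 0 := fun t ht =>
    b.zero_of_le_dist (by simpa using ht)
  have b_one : ∀ t : ℝ, |t| ≤ R → b t = 1 := fun t ht =>
    b.one_of_mem_closedBall (by simpa using ht)
  let B : ℝ → ℝ := fun x => ∫ t in (0 : ℝ)..x, b t
  have hB : ∀ x, HasDerivAt B (b x) x := fun x =>
    (b.continuous.integral_hasStrictDerivAt 0 x).hasDerivAt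
  -- The primitive `B` alone is not compactly supported; subtracting its translate repairs this. The
  -- shift `3 * R` keeps the support of the second bump away from `[-R, R]`. The bumps may overlap
  -- elsewhere, but both take values in `[0, 1]`, so the derivative of `f` stays in `[-1, 1]`.
  let f : ℝ → ℝ := fun x => B x - B (x - 3 * R)
  have hf : ∀ x, HasDerivAt f (b x - b (x - 3 * R)) x := fun x =>
    (hB x).sub ((hB (x - 3 * R)).comp_sub_const x (3 * R))
  have hBs : ContDiff ℝ (⊤ : ℕ∞) B := by
    rw [contDiff_infty_iff_deriv]
    refine ⟨fun x => (hB x).differentiableAt, ?_⟩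
    rw [funext fun x => (hB x).deriv]
    exact b.contDiff
  have hfs : ContDiff ℝ (⊤ : ℕ∞) f := hBs.sub (hBs.comp (contDiff_id.sub contDiff_const))
  have hfi : ∀ x, f x = ∫ t in (x - 3 * R)..x, b t := fun x =>
    intervalIntegral.integral_interval_sub_left (b.continuous.intervalIntegrable _ _)
      (b.continuous.intervalIntegrable _ _)
  have hfb : ∀ x, |f x| ≤ 3 * R := fun x => by
    rw [hfi]
    have h := intervalIntegral.norm_integral_le_of_norm_le_const (a := x - 3 * R) (b := x)
      (C := 1) (f := b) fun t _ => by rw [Real.norm_of_nonneg b.nonneg]; exact b.le_one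
    rw [Real.norm_eq_abs, sub_sub_cancel, abs_of_pos (by positivity : 0 < 3 * R), one_mul] at h
    exact h
  have hf0 : ∀ x, 5 * R ≤ |x| → f x = 0 := fun x hx => by
    rw [hfi]
    refine intervalIntegral.integral_zero_ae (Filter.Eventually.of_forall fun t ht => ?_)
    rw [uIoc_of_le (by linarith)] at ht
    apply b_zero
    rcases le_abs.1 hx with h | h
    · exact le_abs.2 (Or.inl (by linarith [ht.1]))
    · exact le_abs.2 (Or.inr (by linarith [ht.2]))
  let dy : Plane [⋀^Fin 1]→L[ℝ] ℝ :=
    ContinuousAlternatingMap.ofSubsingleton ℝ Plane ℝ 0 (EuclideanSpace.proj (1 : Fin 2))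
  have dy_apply : ∀ u : Plane, dy (fun _ => u) = u 1 := fun u => rfl
  have hdy : ‖dy‖ ≤ 1 := by
    refine dy.opNorm_le_bound zero_le_one fun v => ?_
    have h := PiLp.norm_apply_le (v 0) 1
    simpa [dy] using h
  let p₀ : Plane →L[ℝ] ℝ := EuclideanSpace.proj (0 : Fin 2)
  let p₁ : Plane →L[ℝ] ℝ := EuclideanSpace.proj (1 : Fin 2)
  let h : Plane → ℝ := fun p => f (p₀ p) * b (p₁ p)
  have hh : ContDiff ℝ (⊤ : ℕ∞) h := (hfs.comp p₀.contDiff).mul (b.contDiff.comp p₁.contDiff)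
  have hsupp : HasCompactSupport h := by
    refine HasCompactSupport.intro (isCompact_closedBall (0 : Plane) (7 * R)) fun x hx => ?_
    by_contra hne
    have h0 : |x 0| < 5 * R := lt_of_not_ge fun H => hne (by
      change f (x 0) * _ = 0
      rw [hf0 _ H, zero_mul])
    have h1 : |x 1| < 2 * R := lt_of_not_ge fun H => hne (by
      change _ * b (x 1) = 0
      rw [b_zero _ H, mul_zero])
    apply hx
    rw [mem_closedBall_zero_iff, EuclideanSpace.norm_eq]
    apply Real.sqrt_le_iff.2 ⟨by positivity, ?_⟩
    simp only [Fin.sum_univ_two, Real.norm_eq_abs]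
    nlinarith [abs_nonneg (x 0), abs_nonneg (x 1)]
  -- With only a `dy` component, the derivative of the cutoff in the second coordinate drops out of
  -- `dω`.
  let ω : TestForm 1 := ⟨fun p => h p • dy, hh.smul contDiff_const, hsupp.smul_right⟩
  have hcoeff : ∀ x, coeff (extDerivTest 1 ω) x = (b (x 0) - b (x 0 - 3 * R)) * b (x 1) :=
    fun x => by
    have hd : HasFDerivAt h (fderiv ℝ h x) x := (hh.differentiable (by simp) x).hasFDerivAt
    have hω : fderiv ℝ ω.1 x = (fderiv ℝ h x).smulRight dy := (hd.smul_const dy).fderiv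
    have e : coeff (extDerivTest 1 ω) x = fderiv ℝ h x (stdBasis 0) := by
      change extDeriv ω.1 x stdBasis = _
      rw [extDeriv_one_apply, hω]
      simp [dy_apply]
    have hdf : HasFDerivAt h _ x :=
      ((hf (p₀ x)).comp_hasFDerivAt x p₀.hasFDerivAt).mul
        (((b.contDiff (n := 1)).differentiable (by simp) (p₁ x)).hasFDerivAt.comp x
          p₁.hasFDerivAt)
    rw [e, hdf.fderiv]
    simp [p₀, p₁]
    ring
  refine ⟨3 * R, by positivity, ω, fun x => ?_, fun x => ?_, fun x hx => ?_⟩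
  · change ‖h x • dy‖ ≤ _
    rw [norm_smul, Real.norm_eq_abs, abs_mul, abs_of_nonneg b.nonneg]
    have h1 : |f (p₀ x)| * b (p₁ x) ≤ 3 * R :=
      (mul_le_of_le_one_right (abs_nonneg _) b.le_one).trans (hfb _)
    exact (mul_le_of_le_one_right (mul_nonneg (abs_nonneg _) b.nonneg) hdy).trans h1
  · refine (norm_topForm_le _).trans ?_
    change |coeff (extDerivTest 1 ω) x| ≤ 1
    rw [hcoeff, abs_mul, abs_of_nonneg (b.nonneg (x := x 1))]
    refine mul_le_one₀ (abs_le.2 ⟨?_, ?_⟩) b.nonneg b.le_one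
    · linarith [b.nonneg (x := x 0), b.le_one (x := x 0 - 3 * R)]
    · linarith [b.le_one (x := x 0), b.nonneg (x := x 0 - 3 * R)]
  · rw [mem_ball_zero_iff] at hx
    have h0 : |x 0| ≤ R := (PiLp.norm_apply_le x 0).trans hx.le
    have h1 : |x 1| ≤ R := (PiLp.norm_apply_le x 1).trans hx.le
    rw [hcoeff, b_one _ h0, b_one _ h1, b_zero, sub_zero, mul_one]
    exact le_abs.2 (Or.inr (by linarith [(abs_le.1 h0).2]))

/-! ### Boundaries and the flat norm -/

theorem boundary_add {d : ℕ} (S U : Current (d + 1)) :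
    boundary (S + U) = boundary S + boundary U := LinearMap.add_comp _ _ _

theorem boundary_zero {d : ℕ} : boundary (0 : Current (d + 1)) = 0 := LinearMap.zero_comp _

theorem boundary_sum {d : ℕ} {ι : Type*} (s : Finset ι) (S : ι → Current (d + 1)) :
    boundary (∑ i ∈ s, S i) = ∑ i ∈ s, boundary (S i) := by
  ext φ
  simp only [boundary, LinearMap.comp_apply, LinearMap.sum_apply]

theorem IsIntegralCurrent.zero : IsIntegralCurrent 0 := by
  refine ⟨⟨0, HasCompactSupport.zero, by simp, fun φ => by simp⟩, ?_⟩
  rw [boundary_zero, mass_zero]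
  exact ENNReal.zero_lt_top

theorem IsIntegralCurrent.add {S U : Current 2} (hS : IsIntegralCurrent S)
    (hU : IsIntegralCurrent U) : IsIntegralCurrent (S + U) := by
  obtain ⟨⟨θ, hc, hi, hθ⟩, hb⟩ := hS
  obtain ⟨⟨η, hc', hi', hη⟩, hb'⟩ := hU
  refine ⟨⟨θ + η, hc.add hc', (hi.add hi').congr (Filter.Eventually.of_forall fun x => by simp),
    fun φ => ?_⟩, ?_⟩
  · rw [LinearMap.add_apply, hθ, hη,
      ← integral_add (integrable_mul_coeff hi φ) (integrable_mul_coeff hi' φ)]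
    simp [add_mul]
  · rw [boundary_add]
    exact (mass_add_le _ _).trans_lt (ENNReal.add_lt_top.2 ⟨hb, hb'⟩)

theorem flatNorm_le_flatCost (lam : ℝ) (T : Current 1) {S : Current 2}
    (hS : IsIntegralCurrent S) : flatNorm lam T ≤ flatCost lam T S :=
  iInf_le (fun S : {S : Current 2 // IsIntegralCurrent S} => flatCost lam T S.1) ⟨S, hS⟩

theorem flatNorm_zero (lam : ℝ) : flatNorm lam 0 = 0 := by
  have h := flatNorm_le_flatCost lam 0 IsIntegralCurrent.zero
  rw [flatCost, boundary_zero, sub_zero, mass_zero, mass_zero, mul_zero, add_zero] at h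
  exact le_antisymm h zero_le

theorem flatNorm_add_le (lam : ℝ) (T U : Current 1) :
    flatNorm lam (T + U) ≤ flatNorm lam T + flatNorm lam U := by
  refine ENNReal.le_iInf_add_iInf fun S R => ?_
  refine (flatNorm_le_flatCost lam _ (S.2.add R.2)).trans ?_
  have e : T + U - boundary (S.1 + R.1) = (T - boundary S.1) + (U - boundary R.1) := by
    rw [boundary_add]; abel
  calc flatCost lam (T + U) (S.1 + R.1)
      ≤ (mass (T - boundary S.1) + mass (U - boundary R.1)) +
        ENNReal.ofReal lam * (mass S.1 + mass R.1) := by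
        rw [flatCost, e]
        gcongr
        · exact mass_add_le _ _
        · exact mass_add_le _ _
    _ = _ := by rw [flatCost, flatCost]; ring

theorem flatNorm_sum_le (lam : ℝ) {ι : Type*} (s : Finset ι) (T : ι → Current 1) :
    flatNorm lam (∑ i ∈ s, T i) ≤ ∑ i ∈ s, flatNorm lam (T i) := by
  classical
  induction s using Finset.induction_on with
  | empty => simp [flatNorm_zero]
  | insert a s ha ih =>
    rw [Finset.sum_insert ha, Finset.sum_insert ha]
    exact (flatNorm_add_le lam _ _).trans (by gcongr)

/-! ### A single perturbation -/

section Perturbation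

variable {n : ℕ} {δ : ℝ} {v w : Fin (n + 1) → Plane} {i : Fin (n + 1)} {x : Plane}

/-- The cone condition is the positive orientation of the swept triangle, since adding a multiple of
one column to the other leaves the determinant unchanged. -/
theorem det_left_pos (hx : x ∈ positiveCone δ v i) {j : Fin n} (hj : j.succ = i) :
    0 < det (x - v j.castSucc) (v i - v j.castSucc) := by
  have h := hx.2 j (Or.inr hj)
  rw [hj] at h
  convert h using 1
  simp only [det, PiLp.sub_apply]
  ring

theorem det_right_pos (hx : x ∈ positiveCone δ v i) {j : Fin n} (hj : j.castSucc = i) :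
    0 < det (v j.succ - x) (v i - x) := by
  have h := hx.2 j (Or.inl hj)
  rw [hj] at h
  convert h using 1
  simp only [det, PiLp.sub_apply]
  ring

theorem hasDensityOn_sweptRegion (hx : x ∈ positiveCone δ v i) {K : Set Plane}
    (hK : Convex ℝ K) (hv : ∀ j, v j ∈ K) (hxK : x ∈ K) :
    HasDensityOn K (sweptRegion v i x) := by
  refine HasDensityOn.sum fun j _ => HasDensityOn.add ?_ ?_
  · split_ifs with hj
    · exact hasDensityOn_triangle (det_left_pos hx hj) hK (hv _) hxK (hv _)
    · exact HasDensityOn.zero K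
  · split_ifs with hj
    · exact hasDensityOn_triangle (det_right_pos hx hj) hK hxK (hv _) (hv _)
    · exact HasDensityOn.zero K

theorem mass_pwl_lt_top (v : Fin (n + 1) → Plane) : mass (pwl v) < ∞ :=
  (mass_sum_le _ _).trans_lt (ENNReal.sum_lt_top.2 fun _ _ =>
    (mass_edge_le _ _).trans_lt ENNReal.ofReal_lt_top)

/-- The part of the boundary of the swept region which is not the difference of the old and the
new curve; it vanishes at interior nodes. -/
def sweptDefect (i : Fin (n + 1)) (x y : Plane) : Current 1 :=
  ∑ j : Fin n, ((if j.castSucc = i then edge x y else 0) - (if j.succ = i then edge x y else 0))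

/-- Besides an old and a new edge, the boundary of each triangle contains the diagonal joining `x`
and `v i`; its direction differs for the incoming and the outgoing edge. -/
theorem pwl_update_sub (hx : x ∈ positiveCone δ v i) :
    pwl (Function.update v i x) - pwl v - boundary (sweptRegion v i x) =
      sweptDefect i x (v i) := by
  rw [pwl, pwl, sweptRegion, sweptDefect, boundary_sum, ← Finset.sum_sub_distrib,
    ← Finset.sum_sub_distrib]
  refine Finset.sum_congr rfl fun j _ => ?_
  rw [boundary_add]
  have hne : j.castSucc ≠ j.succ := Fin.castSucc_lt_succ.ne
  by_cases h1 : j.succ = i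
  · have h2 : j.castSucc ≠ i := h1 ▸ hne
    rw [if_pos h1, if_neg h2, if_neg h2, if_pos h1, boundary_zero,
      boundary_triangle (det_left_pos hx h1), Function.update_of_ne h2, h1,
      Function.update_self, edge_swap (v j.castSucc) (v i)]
    abel
  · by_cases h2 : j.castSucc = i
    · rw [if_neg h1, if_pos h2, if_pos h2, if_neg h1, boundary_zero,
        boundary_triangle (det_right_pos hx h2), Function.update_of_ne h1, h2,
        Function.update_self, edge_swap x (v i), edge_swap (v i) (v j.succ)]
      abel
    · rw [if_neg h1, if_neg h2, if_neg h2, if_neg h1, boundary_zero, Function.update_of_ne h1,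
        Function.update_of_ne h2]
      abel

/-- An interior node has exactly one incoming and one outgoing edge, so the two diagonals cancel. -/
theorem sweptDefect_eq_zero (h0 : i ≠ 0) (hn : i ≠ Fin.last n) (x y : Plane) :
    sweptDefect i x y = 0 := by
  obtain ⟨a, rfl⟩ := Fin.exists_succ_eq.2 h0
  obtain ⟨b, hb⟩ := Fin.exists_castSucc_eq.2 hn
  rw [sweptDefect, Finset.sum_sub_distrib, ← hb]
  simp_rw [Fin.castSucc_inj]
  rw [hb]
  simp_rw [Fin.succ_inj]
  simp

theorem supportedIn_sweptDefect {K : Set Plane} (hK : Convex ℝ K) {x y : Plane} (hx : x ∈ K)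
    (hy : y ∈ K) : SupportedIn K (sweptDefect i x y) := by
  have h := supportedIn_edge hK hx hy
  refine SupportedIn.sum fun j _ => SupportedIn.sub ?_ ?_ <;> split_ifs <;>
    first | exact h | exact SupportedIn.zero K

theorem mass_sweptDefect_lt_top (x y : Plane) : mass (sweptDefect i x y) < ∞ := by
  have h : mass (edge x y) < ∞ := (mass_edge_le x y).trans_lt ENNReal.ofReal_lt_top
  have h' : ∀ (p : Prop) [Decidable p], mass (if p then edge x y else 0) < ∞ := fun p _ => by
    split_ifs
    · exact h
    · rw [mass_zero]; exact ENNReal.zero_lt_top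
  refine (mass_sum_le _ _).trans_lt (ENNReal.sum_lt_top.2 fun j _ => ?_)
  rw [sub_eq_add_neg]
  refine (mass_add_le _ _).trans_lt (ENNReal.add_lt_top.2 ⟨h' _, ?_⟩)
  rw [mass_neg]
  exact h' _

theorem mass_boundary_sweptRegion_lt_top (hx : x ∈ positiveCone δ v i) :
    mass (boundary (sweptRegion v i x)) < ∞ := by
  have e : boundary (sweptRegion v i x) =
      pwl (Function.update v i x) + (-pwl v + -sweptDefect i x (v i)) := by
    rw [← pwl_update_sub hx]; abel
  rw [e]
  refine (mass_add_le _ _).trans_lt (ENNReal.add_lt_top.2 ⟨mass_pwl_lt_top _, ?_⟩)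
  refine (mass_add_le _ _).trans_lt (ENNReal.add_lt_top.2 ⟨?_, ?_⟩) <;> rw [mass_neg]
  · exact mass_pwl_lt_top _
  · exact mass_sweptDefect_lt_top _ _

end Perturbation

/-! ### Sequences of perturbations -/

section Sequence

variable {n : ℕ} {δ : ℝ} {v : Fin (n + 1) → Plane} {k₀ k : Fin (n + 1)}
  {T : ℕ → Fin (n + 1) → Plane}

/-- Every node moves at most once, and from its original position, so displacements do not
accumulate. The first clause carries the induction for the second. -/
theorem IsPositiveSequence.nodes (h : IsPositiveSequence δ k₀ k v T) (hδ : 0 < δ) {m : ℕ}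
    (hm : (k₀ : ℕ) ≤ m) (hmk : m ≤ k + 1) :
    (∀ j : Fin (n + 1), m ≤ j → T m j = v j) ∧ ∀ j, T m j ∈ ball (v j) δ := by
  induction m, hm using Nat.le_induction with
  | base =>
    rw [h.1]
    exact ⟨fun _ _ => rfl, fun j => mem_ball_self hδ⟩
  | succ m hm ih =>
    obtain ⟨ih1, ih2⟩ := ih (by omega)
    have hk := k.isLt
    obtain ⟨x, hx, e⟩ := h.2 ⟨m, by omega⟩ hm (Fin.le_def.2 (by simp only; omega))
    simp only at hx e
    rw [e]
    constructor
    · intro j hj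
      rw [Function.update_of_ne, ih1 j (by omega)]
      rintro rfl
      simp only at hj
      omega
    · intro j
      by_cases hj : j = ⟨m, by omega⟩
      · subst hj
        rw [Function.update_self, ← ih1 _ le_rfl]
        exact hx.1.1
      · rw [Function.update_of_ne hj]
        exact ih2 j

theorem IsPositiveSequence.step (h : IsPositiveSequence δ k₀ k v T) {i : Fin (n + 1)}
    (hi : i ∈ Finset.Icc k₀ k) : T (i + 1) i ∈ positiveCone δ (T i) i ∧
      T (i + 1) = Function.update (T i) i (T (i + 1) i) := by
  rw [Finset.mem_Icc] at hi
  obtain ⟨x, hx, e⟩ := h.2 i hi.1 hi.2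
  have e' : T (i + 1) i = x := by rw [e, Function.update_self]
  rw [e']
  exact ⟨hx.1, e⟩

theorem sum_Icc_succ_sub {G : Type*} [AddCommGroup G] (f : ℕ → G) (h : k₀ ≤ k) :
    ∑ i ∈ Finset.Icc k₀ k, (f (i + 1) - f i) = f (k + 1) - f k₀ := by
  have e := Finset.sum_map (Finset.Icc k₀ k) Fin.valEmbedding fun i : ℕ => f (i + 1) - f i
  rw [Fin.map_valEmbedding_Icc] at e
  simp only [Fin.valEmbedding_apply] at e
  rw [← e, ← Finset.Ico_succ_right_eq_Icc]
  exact Finset.sum_Ico_sub f (by simp; omega)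

theorem IsPositiveSequence.hasDensityOn (h : IsPositiveSequence δ k₀ k v T) (hδ : 0 < δ)
    {K : Set Plane} (hK : Convex ℝ K) (hv : ∀ j, ball (v j) δ ⊆ K) {i : Fin (n + 1)}
    (hi : i ∈ Finset.Icc k₀ k) : HasDensityOn K (sweptRegion (T i) i (T (i + 1) i)) := by
  have hi' := Finset.mem_Icc.1 hi
  have h1 := Fin.le_def.1 hi'.1
  have h2 := Fin.le_def.1 hi'.2
  exact hasDensityOn_sweptRegion (h.step hi).1 hK
    (fun j => hv j ((h.nodes hδ h1 (by omega)).2 j))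
    (hv i ((h.nodes hδ (m := i + 1) (by omega) (by omega)).2 i))

/-- The nodes of a curve and their neighbourhoods lie in a common ball. -/
theorem ball_subset_ball_sum (v : Fin (n + 1) → Plane) (δ : ℝ) (j : Fin (n + 1)) :
    ball (v j) δ ⊆ ball 0 (∑ j, ‖v j‖ + δ) := by
  apply ball_subset_ball'
  rw [dist_zero_right, add_comm]
  gcongr
  exact Finset.single_le_sum (f := fun j => ‖v j‖) (fun _ _ => norm_nonneg _) (Finset.mem_univ j)

theorem IsPositiveSequence.sub_boundary_void (h : IsPositiveSequence δ k₀ k v T) (hk : k₀ ≤ k) :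
    pwl (T (k + 1)) - pwl (T k₀) - boundary (void k₀ k T) =
      ∑ i ∈ Finset.Icc k₀ k, sweptDefect i (T (i + 1) i) (T i i) := by
  rw [← sum_Icc_succ_sub (fun m => pwl (T m)) hk, void, boundary_sum, ← Finset.sum_sub_distrib]
  refine Finset.sum_congr rfl fun i hi => ?_
  rw [← pwl_update_sub (h.step hi).1, ← (h.step hi).2]

/-- If filling the void is optimal then the flat norm distances add up. -/
theorem IsPositiveSequence.isAdditive (h : IsPositiveSequence δ k₀ k v T) (hδ : 0 < δ) {M : ℝ}
    (hM : δ < M) (hv : ∀ i j, i ≠ j → 2 * M ≤ dist (v i) (v j)) (hk : k₀ ≤ k) {lam : ℝ}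
    (hf : FilledVoids lam k₀ k T) : IsAdditive lam k₀ k T := by
  have hd := fun i (hi : i ∈ Finset.Icc k₀ k) =>
    h.hasDensityOn hδ (convex_ball 0 _) (ball_subset_ball_sum v δ) hi
  refine le_antisymm ?_ ?_
  · rw [← sum_Icc_succ_sub (fun m => pwl (T m)) hk]
    exact flatNorm_sum_le _ _ _
  -- By optimality the flat norm is the cost of the void, whose area term is already a sum over the
  -- steps. The length term is split below by separation of the defects.
  · rw [← hf.2, flatCost, h.sub_boundary_void hk, void, HasDensityOn.mass_sum hd, Finset.mul_sum]
    have hD : ∀ i ∈ Finset.Icc k₀ k,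
        SupportedIn (ball (v i) δ) (sweptDefect i (T (i + 1) i) (T i i)) := fun i hi => by
      have hi' := Finset.mem_Icc.1 hi
      have h1 := Fin.le_def.1 hi'.1
      have h2 := Fin.le_def.1 hi'.2
      exact supportedIn_sweptDefect (convex_ball _ _)
        ((h.nodes hδ (m := i + 1) (by omega) (by omega)).2 i)
        ((h.nodes hδ h1 (by omega)).2 i)
    refine le_trans ?_ (add_le_add (sum_mass_le_of_separated hδ hM hv hD) le_rfl)
    rw [← Finset.sum_add_distrib]
    refine Finset.sum_le_sum fun i hi => ?_
    have hc := (h.step hi).1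
    have hint := (hd i hi).isIntegralCurrent (mass_boundary_sweptRegion_lt_top hc)
    refine (flatNorm_le_flatCost lam _ hint).trans_eq ?_
    rw [flatCost, ← pwl_update_sub hc, ← (h.step hi).2]

/-- `S` attains its mass on `dω`, whereas a competitor `U` has at least its value there. Passing
from `S` to `U` changes this value by `(∂S - ∂U)(ω)`, which after scaling by `lam` is paid for by
the length term. -/
theorem flatCost_le_of_calibration {R C lam : ℝ} (hlam : 0 < lam) (hC : lam * C ≤ 1)
    {ω : TestForm 1} (hω : ∀ x, ‖ω.1 x‖ ≤ C) (hdω : ∀ x, ‖(extDerivTest 1 ω).1 x‖ ≤ 1)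
    (h1 : ∀ x ∈ ball (0 : Plane) R, coeff (extDerivTest 1 ω) x = 1) {S : Current 2}
    (hS : HasDensityOn (ball 0 R) S) (U : Current 2) :
    flatCost lam (boundary S) S ≤ flatCost lam (boundary S) U := by
  rw [flatCost, sub_self, mass_zero, zero_add, hS.mass_eq hdω h1, ← ENNReal.ofReal_mul hlam.le]
  have e : lam * S (extDerivTest 1 ω) =
      (boundary S - boundary U) (lam • ω) + lam * U (extDerivTest 1 ω) := by
    have e1 : boundary S ω = S (extDerivTest 1 ω) := rfl
    have e2 : boundary U ω = U (extDerivTest 1 ω) := rfl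
    rw [LinearMap.sub_apply, map_smul, map_smul, e1, e2, smul_eq_mul, smul_eq_mul]
    ring
  rw [e]
  refine ENNReal.ofReal_add_le.trans (add_le_add (ofReal_apply_le_mass _ _ fun x => ?_) ?_)
  · change ‖lam • ω.1 x‖ ≤ 1
    rw [norm_smul, Real.norm_of_nonneg hlam.le]
    exact (mul_le_mul_of_nonneg_left (hω x) hlam.le).trans hC
  · rw [ENNReal.ofReal_mul hlam.le]
    gcongr
    exact ofReal_apply_le_mass U _ hdω

theorem IsPositiveSequence.filledVoids (h : IsPositiveSequence δ k₀ k v T) (hδ : 0 < δ)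
    (hk : k₀ ≤ k) (h0 : k₀ ≠ 0) (hn : k ≠ Fin.last n) {R C lam : ℝ}
    (hv : ∀ j, ball (v j) δ ⊆ ball 0 R) (hlam : 0 < lam) (hC : lam * C ≤ 1)
    {ω : TestForm 1} (hω : ∀ x, ‖ω.1 x‖ ≤ C) (hdω : ∀ x, ‖(extDerivTest 1 ω).1 x‖ ≤ 1)
    (h1 : ∀ x ∈ ball (0 : Plane) R, coeff (extDerivTest 1 ω) x = 1) :
    FilledVoids lam k₀ k T := by
  have hd : HasDensityOn (ball 0 R) (void k₀ k T) :=
    HasDensityOn.sum fun i hi => h.hasDensityOn hδ (convex_ball 0 _) hv hi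
  have hb : pwl (T (k + 1)) - pwl (T k₀) = boundary (void k₀ k T) := by
    rw [← sub_eq_zero, h.sub_boundary_void hk]
    refine Finset.sum_eq_zero fun i hi => sweptDefect_eq_zero ?_ ?_ _ _
    · exact ((Fin.pos_iff_ne_zero.2 h0).trans_le (Finset.mem_Icc.1 hi).1).ne'
    · exact ((Finset.mem_Icc.1 hi).2.trans_lt (Fin.lt_last_iff_ne_last.2 hn)).ne
  have hint : IsIntegralCurrent (void k₀ k T) := by
    refine hd.isIntegralCurrent ?_
    rw [← hb, sub_eq_add_neg]
    refine (mass_add_le _ _).trans_lt (ENNReal.add_lt_top.2 ⟨mass_pwl_lt_top _, ?_⟩)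
    rw [mass_neg]
    exact mass_pwl_lt_top _
  refine ⟨hint, le_antisymm (le_iInf fun U => ?_) (flatNorm_le_flatCost _ _ hint)⟩
  rw [hb]
  exact flatCost_le_of_calibration hlam hC hω hdω h1 hd U.1

end Sequence

/-! ### Separation of the nodes and the main theorem -/

theorem exists_separation {n : ℕ} {v : Fin (n + 1) → Plane} (hv : Function.Injective v) :
    ∃ M : ℝ, 0 < M ∧ ∀ i j, i ≠ j → 2 * M ≤ dist (v i) (v j) := by
  have h : ∀ᶠ M : ℝ in nhdsWithin 0 (Ioi 0), ∀ i j, i ≠ j → 2 * M ≤ dist (v i) (v j) := by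
    rw [Filter.eventually_all]
    intro i
    rw [Filter.eventually_all]
    intro j
    by_cases hij : i = j
    · exact Filter.Eventually.of_forall fun _ h => absurd hij h
    · have hpos : 0 < dist (v i) (v j) / 2 := half_pos (dist_pos.2 fun e => hij (hv e))
      filter_upwards [nhdsWithin_le_nhds (Iio_mem_nhds hpos)] with M hM _
      rw [mem_Iio] at hM
      linarith
  obtain ⟨M, hM, hpos⟩ := (h.and self_mem_nhdsWithin).exists
  exact ⟨M, hpos, hM⟩

end PlaneCurrent

end

open PlaneCurrent
theorem mainTheorem6 (n : ℕ) (hn : 2 ≤ n) (v : Fin (n + 1) → Plane) (hv : IsSimple v) :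
    (∃ M₀ : ℝ, 0 < M₀ ∧ ∀ lam : ℝ, 0 < lam → ∀ δ : ℝ, 0 < δ → δ < M₀ →
      ∀ k₀ k : Fin (n + 1), k₀ < k → ∀ T : ℕ → Fin (n + 1) → Plane,
        IsPositiveSequence δ k₀ k v T → FilledVoids lam k₀ k T → IsAdditive lam k₀ k T) ∧
    (∃ lam₀ : ℝ, 0 < lam₀ ∧ ∀ lam : ℝ, 0 < lam → lam < lam₀ →
      ∃ M : ℝ, 0 < M ∧ ∀ δ : ℝ, 0 < δ → δ < M →
        ∀ k₀ k : Fin (n + 1), k₀ < k → k₀ ≠ 0 → k ≠ Fin.last n →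
          ∀ T : ℕ → Fin (n + 1) → Plane, IsPositiveSequence δ k₀ k v T →
            FilledVoids lam k₀ k T ∧ IsAdditive lam k₀ k T) := by
  obtain ⟨M, hM, hsep⟩ := exists_separation hv.1
  refine ⟨⟨M, hM, fun lam _ δ hδ hδM k₀ k hk T hT hf =>
    hT.isAdditive hδ hδM hsep hk.le hf⟩, ?_⟩
  -- The summand `1` leaves room for displacements `δ < 1`, so the calibration, and with it the
  -- threshold `1 / C`, depends only on the initial curve.
  have hR : 0 < ∑ j, ‖v j‖ + 1 := by positivity
  obtain ⟨C, hC, ω, hω, hdω, h1⟩ := exists_calibration hR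
  refine ⟨1 / C, by positivity, fun lam hlam hlam₀ => ⟨min M 1, by positivity,
    fun δ hδ hδM k₀ k hk h0 hn T hT => ?_⟩⟩
  obtain ⟨hδ1, hδ2⟩ := lt_min_iff.1 hδM
  have hf : FilledVoids lam k₀ k T := hT.filledVoids hδ hk.le h0 hn
    (fun j => (ball_subset_ball_sum v δ j).trans (ball_subset_ball (by linarith)))
    hlam ((lt_div_iff₀ hC).1 hlam₀).le hω hdω h1
  exact ⟨hf, hT.isAdditive hδ hδ1 hsep hk.le hf⟩
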